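/- Let $k$ be an algebraically closed field and let $A$ be an associative $k$-algebra with Jacobson radical $\operatorname{rad}A$. Assume that $A$ is left and right Noetherian, that $A$ is semiperfect (that is, $A/\operatorname{rad}A$ is semisimple and idempotents lift modulo $\operatorname{rad}A$), and that $A/\operatorname{rad}A$ is finite dimensional over $k$. Let $e\in A$ be a primitive idempotent such that the right $A$-module $eA$ is not isomorphic to a direct summand of $(1-e)A$ (this holds for every primitive idempotent $e$ if $A$ is basic, that is, if $A/\operatorname{rad}A$ is a product of division algebras). Let $S_e=eA/e\operatorname{rad}A$ be the simple right $A$-module at $e$, let $\Gamma=(1-e)A(1-e)$, and let $F=\operatorname{Hom}_A((1-e)A,-)$ be the functor from right $A$-modules to right $\Gamma$-modules, so that $F(eA)=eA(1-e)$. Suppose that $\operatorname{Ext}^1_A(S_e,S_e)=0$. If both projective dimensions $\operatorname{pd}_A S_e$ and $\operatorname{pd}_\Gamma F(eA)=\operatorname{pd}_\Gamma\bigl(eA(1-e)\bigr)$ are finite, then $S_e$ is self-orthogonal, that is, $\operatorname{Ext}^i_A(S_e,S_e)=0$ for all $i>0$. -/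

import Mathlib

open CategoryTheory MulOpposite

universe u

/-!
Conventions: a right module over a ring `A` is a module over the opposite ring `Aᵐᵒᵖ`, so that
`MulOpposite.op a • m` is `m * a`.  The category of right `A`-modules is `ModuleCat Aᵐᵒᵖ`.
-/

/-- A ring `A` is semiperfect if `A / rad A` is semisimple and idempotents lift modulo `rad A`,
where `rad A` is the Jacobson radical. -/
structure IsSemiperfectRing (A : Type u) [Ring A] : Prop where
  isSemisimpleRing : IsSemisimpleRing (A ⧸ Ring.jacobson A)
  exists_lift : ∀ x : A, x * x - x ∈ Ring.jacobson A →
    ∃ f : A, IsIdempotentElem f ∧ f - x ∈ Ring.jacobson A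

/-- An idempotent is primitive if it is nonzero and is not the sum of two nonzero orthogonal
idempotents. -/
structure IsPrimitiveIdempotent {A : Type u} [Ring A] (e : A) : Prop where
  isIdempotentElem : IsIdempotentElem e
  ne_zero : e ≠ 0
  eq_zero_or_eq_zero : ∀ f g : A, IsIdempotentElem f → IsIdempotentElem g →
    f * g = 0 → g * f = 0 → e = f + g → f = 0 ∨ g = 0

/-- The right ideal `eA` of `A`, as a right `A`-module. -/
def rightIdeal {A : Type u} [Ring A] (e : A) : Submodule Aᵐᵒᵖ A where
  carrier := {x | ∃ a : A, x = e * a}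
  add_mem' := by
    rintro _ _ ⟨a, rfl⟩ ⟨b, rfl⟩
    exact ⟨a + b, by rw [mul_add]⟩
  zero_mem' := ⟨0, by rw [mul_zero]⟩
  smul_mem' := by
    rintro c _ ⟨a, rfl⟩
    exact ⟨a * c.unop, by rw [MulOpposite.smul_eq_mul_unop, mul_assoc]⟩

/-- The submodule `e rad A` of the right `A`-module `eA`. -/
def rightIdealRad {A : Type u} [Ring A] (e : A) : Submodule Aᵐᵒᵖ (rightIdeal e) where
  carrier := {x | ∃ r ∈ Ring.jacobson A, (x : A) = e * r}
  add_mem' := by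
    rintro x y ⟨a, ha, hx⟩ ⟨b, hb, hy⟩
    exact ⟨a + b, add_mem ha hb, by rw [Submodule.coe_add, hx, hy, mul_add]⟩
  zero_mem' := ⟨0, zero_mem _, by rw [Submodule.coe_zero, mul_zero]⟩
  smul_mem' := by
    rintro c x ⟨a, ha, hx⟩
    exact ⟨a * c.unop, Ideal.mul_mem_right _ _ ha, by
      rw [Submodule.coe_smul, hx, MulOpposite.smul_eq_mul_unop, mul_assoc]⟩

/-- The right `A`-module `S_e = eA / e rad A`, the top of `eA`. -/
abbrev topAt {A : Type u} [Ring A] (e : A) : Type u := rightIdeal e ⧸ rightIdealRad e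

/-- For an idempotent `f` of `A` and a right `A`-module `M`, the additive group `M f`.
With `f = 1 - e` this is the value at `M` of the functor `F = Hom_A((1-e)A, -)`, where a linear map
`φ` corresponds to the element `φ (1 - e)` of `M (1 - e)`. -/
def cornerPart {A : Type u} [Ring A] (f : A) (M : Type u) [AddCommGroup M] [Module Aᵐᵒᵖ M] :
    AddSubgroup M where
  carrier := {m | ∃ n : M, m = op f • n}
  add_mem' := by
    rintro _ _ ⟨a, rfl⟩ ⟨b, rfl⟩
    exact ⟨a + b, by rw [smul_add]⟩
  zero_mem' := ⟨0, by rw [smul_zero]⟩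
  neg_mem' := by
    rintro _ ⟨a, rfl⟩
    exact ⟨-a, by rw [smul_neg]⟩

/-- `M f` as a right module over the ring `fAf`, which is Mathlib's `hf.Corner`; the action
is the restriction of that of `A` on `M`. -/
instance cornerPart.instModule {A : Type u} [Ring A] {f : A} (hf : IsIdempotentElem f)
    (M : Type u) [AddCommGroup M] [Module Aᵐᵒᵖ M] :
    Module (hf.Corner)ᵐᵒᵖ (cornerPart f M) where
  smul c m := ⟨op (c.unop.1 : A) • (m : M), by
    refine ⟨op (c.unop.1 : A) • (m : M), ?_⟩
    rw [smul_smul, ← op_mul, ((Subsemigroup.mem_corner_iff hf).mp c.unop.2).2]⟩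
  one_smul := by
    rintro ⟨_, n, rfl⟩
    apply Subtype.ext
    change op f • op f • n = op f • n
    rw [smul_smul, ← op_mul, hf.eq]
  mul_smul := by
    intro c d m
    apply Subtype.ext
    change op ((d.unop.1 : A) * (c.unop.1 : A)) • (m : M) =
      op (c.unop.1 : A) • op (d.unop.1 : A) • (m : M)
    rw [smul_smul, ← op_mul]
  smul_zero := by
    intro c
    apply Subtype.ext
    exact smul_zero _
  smul_add := by
    intro c m n
    apply Subtype.ext
    exact smul_add _ _ _
  add_smul := by
    intro c d m
    apply Subtype.ext
    exact add_smul (op (c.unop.1 : A)) (op (d.unop.1 : A)) (m : M)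
  zero_smul := by
    intro m
    apply Subtype.ext
    exact zero_smul Aᵐᵒᵖ (m : M)

/-- `IsSummandOf R M N`: the `R`-module `M` is isomorphic to a direct summand of `N`. -/
def IsSummandOf (R : Type u) [Ring R] (M N : Type u) [AddCommGroup M] [Module R M]
    [AddCommGroup N] [Module R N] : Prop :=
  ∃ N₁ N₂ : Submodule R N, IsCompl N₁ N₂ ∧ Nonempty (M ≃ₗ[R] N₁)

/-- The group `Ext^i_R(M, M)` vanishes. -/
def SelfExtVanishes (R : Type u) [Ring R] (M : Type u) [AddCommGroup M] [Module R M]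
    (i : ℕ) : Prop :=
  Subsingleton (Abelian.Ext (ModuleCat.of R M) (ModuleCat.of R M) i)

/-- `M` is self-orthogonal: `Ext^i_R(M, M) = 0` for all `i > 0`. -/
def IsSelfOrthogonal (R : Type u) [Ring R] (M : Type u) [AddCommGroup M] [Module R M] : Prop :=
  ∀ i : ℕ, 0 < i → SelfExtVanishes R M i

/-- The `R`-module `M` has finite projective dimension. -/
def HasFiniteProjDim (R : Type u) [Ring R] (M : Type u) [AddCommGroup M] [Module R M] : Prop :=
  projectiveDimension (ModuleCat.of R M) < ⊤

/-!
Write `f = 1 - e`, `S = S_e` and `Γ = fAf`.  Suppose `Ext^i(S, S) ≠ 0` for some `i > 0`, and let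
`m > 0` be the largest such degree, which exists because `S` has finite projective dimension.

Two facts on modules are needed.  The hypothesis on `eA` gives `S f = 0`
(`smul_one_sub_topAt`), and `Ext^1(S, S) = 0` forces `e rad A` into the ideal `AfA`
(`mul_mem_span_of_ext_one`), so that every module killed by `f` is a direct sum of copies of `S`
(`exists_linearEquiv_finsupp_topAt`).

The core is `extVanishes_of_cornerPart`: if `Z f` has finite projective dimension over `Γ` and
`Ext^j(Z, S) = 0` for all `j ≥ m`, then `Ext^j(Z, S) = 0` for all `j`.  The proof is by induction on
the projective dimension of `Z f`.  By `exists_cover` there is a projective module `P` generated by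
`f`, so that `Ext(P, S) = 0`, and a map `π : P → Z` whose image `B` contains `Z f` and for
which `(ker π) f` is a syzygy of `Z f`, zero if `Z f` is projective.  The quotient `H = Z / B` is
killed by `f`, hence a direct sum of copies of `S`, hence without `Ext` into `S` above degree `m`.
Long exact sequences carry the vanishing in degrees `≥ m` from `Z` to `B` and to `ker π`; by
induction `Ext(ker π, S) = 0`, thus `Ext(B, S) = 0`, thus `Ext^m(H, S) = Ext^m(Z, S) = 0`.  As
`Ext^m(S, S) ≠ 0`, this means `H = 0`, so that `Z = B`.

For `Z = eA`, which is projective, the hypotheses hold because `m > 0`, and the conclusion in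
degree `0` contradicts the existence of the projection `eA → S`.
-/

/-! ### Vanishing of `Ext` -/

/-- The group `Ext^i_R(M, N)` vanishes. -/
def ExtVanishes (R : Type u) [Ring R] (M N : Type u) [AddCommGroup M] [Module R M]
    [AddCommGroup N] [Module R N] (i : ℕ) : Prop :=
  Subsingleton (Abelian.Ext (ModuleCat.of R M) (ModuleCat.of R N) i)

namespace ExtVanishes

variable {R : Type u} [Ring R] {K M N : Type u} [AddCommGroup K] [Module R K]
  [AddCommGroup M] [Module R M] [AddCommGroup N] [Module R N] {i : ℕ}

open Abelian

/-- `Ext^i(K, N)` is a direct summand of `Ext^i(M, N)` when `K` is a retract of `M`. -/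
lemma of_retract (j : K →ₗ[R] M) (p : M →ₗ[R] K) (hpj : p ∘ₗ j = LinearMap.id)
    (h : ExtVanishes R M N i) : ExtVanishes R K N i := by
  have h' : Subsingleton (Ext (ModuleCat.of R M) (ModuleCat.of R N) i) := h
  refine subsingleton_of_forall_eq 0 fun x => ?_
  have hid : ModuleCat.ofHom j ≫ ModuleCat.ofHom p = 𝟙 (ModuleCat.of R K) := by
    rw [← ModuleCat.ofHom_comp, hpj]; rfl
  rw [← x.mk₀_id_comp, ← hid, ← Ext.mk₀_comp_mk₀, Ext.comp_assoc_of_second_deg_zero,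
    Subsingleton.elim ((Ext.mk₀ (ModuleCat.ofHom p)).comp x (zero_add i)) 0, Ext.comp_zero]

lemma of_linearEquiv (φ : K ≃ₗ[R] M) (h : ExtVanishes R M N i) : ExtVanishes R K N i :=
  of_retract φ.toLinearMap φ.symm.toLinearMap (by ext; simp) h

lemma of_subsingleton [Subsingleton K] : ExtVanishes R K N i := by
  refine subsingleton_of_forall_eq 0 fun x => ?_
  have hid : 𝟙 (ModuleCat.of R K) = 0 := by
    ext y
    exact Subsingleton.elim (α := K) _ _
  rw [← x.mk₀_id_comp, hid, Ext.mk₀_zero, Ext.zero_comp]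

lemma of_projective [Module.Projective R M] : ExtVanishes R M N (i + 1) := by
  have : Projective (ModuleCat.of R M) :=
    (IsProjective.iff_projective (R := R) (P := M)).mp inferInstance
  exact Ext.subsingleton_of_projective _ _ _

lemma zero_iff : ExtVanishes R M N 0 ↔ ∀ φ : M →ₗ[R] N, φ = 0 := by
  constructor
  · intro h φ
    have h' : Subsingleton (Ext (ModuleCat.of R M) (ModuleCat.of R N) 0) := h
    have h1 : ModuleCat.ofHom φ = 0 := Ext.homEquiv₀.symm.injective (Subsingleton.elim _ _)
    exact congrArg ModuleCat.Hom.hom h1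
  · intro h
    have : Subsingleton (ModuleCat.of R M ⟶ ModuleCat.of R N) :=
      subsingleton_of_forall_eq 0 fun φ => by
        ext x
        exact congrArg (fun ψ : M →ₗ[R] N => ψ x) (h φ.hom)
    exact Ext.homEquiv₀.subsingleton

variable {π : M →ₗ[R] K}

-- The next lemmas read off vanishing from the long exact sequence of `0 → ker π → M → K → 0`.

lemma middle (hπ : Function.Surjective π) (h₁ : ExtVanishes R (LinearMap.ker π) N i)
    (h₃ : ExtVanishes R K N i) : ExtVanishes R M N i := by
  have hS := LinearMap.shortExact_shortComplexKer hπ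
  refine subsingleton_of_forall_eq 0 fun x => ?_
  obtain ⟨y, rfl⟩ := Ext.contravariant_sequence_exact₂ hS (ModuleCat.of R N) x (h₁.elim _ _)
  rw [show y = 0 from h₃.elim _ _]
  apply Ext.comp_zero

lemma ker (hπ : Function.Surjective π) (h₂ : ExtVanishes R M N i)
    (h₃ : ExtVanishes R K N (i + 1)) : ExtVanishes R (LinearMap.ker π) N i := by
  have hS := LinearMap.shortExact_shortComplexKer hπ
  refine subsingleton_of_forall_eq 0 fun x => ?_
  obtain ⟨y, rfl⟩ := Ext.contravariant_sequence_exact₁ hS (ModuleCat.of R N) x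
    (add_comm 1 i) (h₃.elim _ _)
  rw [show y = 0 from h₂.elim _ _]
  apply Ext.comp_zero

lemma target_succ (hπ : Function.Surjective π) (h₁ : ExtVanishes R (LinearMap.ker π) N i)
    (h₂ : ExtVanishes R M N (i + 1)) : ExtVanishes R K N (i + 1) := by
  have hS := LinearMap.shortExact_shortComplexKer hπ
  refine subsingleton_of_forall_eq 0 fun x => ?_
  obtain ⟨y, rfl⟩ := Ext.contravariant_sequence_exact₃ hS (ModuleCat.of R N) x (h₂.elim _ _)
    (add_comm 1 i)
  rw [show y = 0 from h₁.elim _ _]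
  apply Ext.comp_zero

lemma target_zero (hπ : Function.Surjective π) (h₂ : ExtVanishes R M N 0) :
    ExtVanishes R K N 0 := by
  rw [zero_iff] at h₂ ⊢
  intro φ
  ext y
  obtain ⟨x, rfl⟩ := hπ y
  exact congrArg (fun ψ : M →ₗ[R] N => ψ x) (h₂ (φ ∘ₗ π))

lemma target (hπ : Function.Surjective π) (h₁ : ∀ j, ExtVanishes R (LinearMap.ker π) N j)
    (h₂ : ExtVanishes R M N i) : ExtVanishes R K N i := by
  cases i with
  | zero => exact target_zero hπ h₂
  | succ i => exact target_succ hπ (h₁ i) h₂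

/-- If `Ext^1(K, N) = 0`, every linear map from the kernel of a surjection `M → K` to `N`
extends to `M`. -/
lemma exists_extend (hπ : Function.Surjective π) (h₃ : ExtVanishes R K N 1)
    (φ : LinearMap.ker π →ₗ[R] N) :
    ∃ ψ : M →ₗ[R] N, ∀ x : LinearMap.ker π, ψ x = φ x := by
  have hS := LinearMap.shortExact_shortComplexKer hπ
  obtain ⟨y, hy⟩ := Ext.contravariant_sequence_exact₁ hS (ModuleCat.of R N)
    (Ext.mk₀ (ModuleCat.ofHom φ)) (add_comm 1 0) (h₃.elim _ _)
  obtain ⟨ψ, rfl⟩ := Ext.homEquiv₀.symm.surjective y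
  rw [Ext.homEquiv₀_symm_apply, Ext.mk₀_comp_mk₀] at hy
  have h1 := Ext.homEquiv₀.symm.injective hy
  exact ⟨ψ.hom, fun x => congrArg (fun χ => χ.hom x) h1⟩

/-- Vanishing of `Ext^i(-, N)` passes to arbitrary direct sums of copies of a module.  The proof
shifts dimension along an embedding of `N` into an injective module. -/
lemma finsupp (ι : Type u) (h : ExtVanishes R M N i) : ExtVanishes R (ι →₀ M) N i := by
  induction i generalizing N with
  | zero =>
    rw [zero_iff] at h ⊢
    intro φ
    ext a x
    exact congrArg (fun ψ : M →ₗ[R] N => ψ x) (h (φ ∘ₗ Finsupp.lsingle a))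
  | succ i ih =>
    obtain ⟨p⟩ := EnoughInjectives.presentation (ModuleCat.of R N)
    have hS : (ShortComplex.mk _ _ (Limits.cokernel.condition p.f)).ShortExact :=
      { exact := ShortComplex.exact_cokernel p.f }
    refine subsingleton_of_forall_eq 0 fun x => ?_
    obtain ⟨y, rfl⟩ := Ext.covariant_sequence_exact₁ _ hS x (Ext.eq_zero_of_injective _) rfl
    cases i with
    | zero =>
      -- Each component of the map `y` lifts to the injective module, hence so does `y`.
      obtain ⟨φ, rfl⟩ := Ext.homEquiv₀.symm.surjective y
      have lift : ∀ a : ι, ∃ ψ : M →ₗ[R] p.J,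
          (Limits.cokernel.π p.f).hom ∘ₗ ψ = φ.hom ∘ₗ Finsupp.lsingle a := by
        intro a
        obtain ⟨z, hz⟩ := Ext.covariant_sequence_exact₃ (ModuleCat.of R M) hS
          (Ext.mk₀ (ModuleCat.ofHom (φ.hom ∘ₗ Finsupp.lsingle a))) rfl (h.elim _ _)
        obtain ⟨ψ, rfl⟩ := Ext.homEquiv₀.symm.surjective z
        rw [Ext.homEquiv₀_symm_apply, Ext.mk₀_comp_mk₀] at hz
        exact ⟨ψ.hom, congrArg ModuleCat.Hom.hom (Ext.homEquiv₀.symm.injective hz)⟩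
      choose ψ hψ using lift
      have hφ : φ = ModuleCat.ofHom (Finsupp.lsum ℕ ψ) ≫ Limits.cokernel.π p.f := by
        apply ModuleCat.hom_ext
        apply Finsupp.lhom_ext'
        intro a
        rw [← hψ a]
        ext x
        simp
      rw [Ext.homEquiv₀_symm_apply, hφ, ← Ext.mk₀_comp_mk₀,
        Ext.comp_assoc_of_second_deg_zero]
      rw [show (Ext.mk₀ (Limits.cokernel.π p.f)).comp hS.extClass (zero_add 1) = 0 from
        hS.comp_extClass]
      apply Ext.comp_zero
    | succ i =>
      have h' : ExtVanishes R M (Limits.cokernel p.f : ModuleCat R) (i + 1) := by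
        refine subsingleton_of_forall_eq 0 fun z => ?_
        obtain ⟨w, hw⟩ := Ext.covariant_sequence_exact₃ (ModuleCat.of R M) hS z rfl (h.elim _ _)
        rw [← hw, Ext.eq_zero_of_injective w]
        apply Ext.zero_comp
      rw [show y = 0 from (ih h').elim _ _]
      apply Ext.zero_comp

end ExtVanishes

/-! ### The functor `M ↦ M f` and covers by projectives generated by `f` -/

section Corner

variable {A : Type u} [Ring A]

lemma mem_rightIdeal_iff {e : A} (he : IsIdempotentElem e) {x : A} :
    x ∈ rightIdeal e ↔ e * x = x := by
  constructor
  · rintro ⟨a, rfl⟩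
    rw [← mul_assoc, he.eq]
  · intro h
    exact ⟨x, h.symm⟩

lemma mem_cornerPart_iff {f : A} (hf : IsIdempotentElem f) {M : Type u} [AddCommGroup M]
    [Module Aᵐᵒᵖ M] {m : M} : m ∈ cornerPart f M ↔ op f • m = m := by
  constructor
  · rintro ⟨n, rfl⟩
    rw [smul_smul, ← op_mul, hf.eq]
  · intro h
    exact ⟨m, h.symm⟩

lemma smul_mem_cornerPart {f : A} {M : Type u} [AddCommGroup M] [Module Aᵐᵒᵖ M] (m : M) :
    op f • m ∈ cornerPart f M := ⟨m, rfl⟩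

/-- The linear map `eA → M` sending `a` to `m a`, for `m` in a right module `M`. -/
def rightIdealLift {M : Type u} [AddCommGroup M] [Module Aᵐᵒᵖ M] (e : A) (m : M) :
    rightIdeal e →ₗ[Aᵐᵒᵖ] M where
  toFun a := op (a : A) • m
  map_add' a b := add_smul (op (a : A)) (op (b : A)) m
  map_smul' c a := by
    rw [Submodule.coe_smul, MulOpposite.smul_eq_mul_unop, op_mul, op_unop, mul_smul,
      RingHom.id_apply]

variable {M N : Type u} [AddCommGroup M] [Module Aᵐᵒᵖ M] [AddCommGroup N] [Module Aᵐᵒᵖ N]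

lemma rightIdealLift_apply (e : A) (m : M) (a : rightIdeal e) :
    rightIdealLift e m a = op (a : A) • m := rfl

/-- The idempotent `e` as an element of `eA`. -/
def rightIdealOne (e : A) : rightIdeal e := ⟨e, 1, (mul_one e).symm⟩

lemma smul_rightIdealOne {e : A} (he : IsIdempotentElem e) (a : rightIdeal e) :
    op (a : A) • rightIdealOne e = a :=
  Subtype.ext ((mem_rightIdeal_iff he).mp a.2)

lemma projective_rightIdeal {e : A} (he : IsIdempotentElem e) :
    Module.Projective Aᵐᵒᵖ (rightIdeal e) := by
  let j : rightIdeal e →ₗ[Aᵐᵒᵖ] Aᵐᵒᵖ :=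
    { toFun a := op (a : A)
      map_add' _ _ := rfl
      map_smul' _ _ := rfl }
  refine Module.Projective.of_split j (LinearMap.toSpanSingleton _ _ (rightIdealOne e)) ?_
  ext a
  exact congrArg Subtype.val (smul_rightIdealOne he a)

variable {f : A} (hf : IsIdempotentElem f)

/-- The linear map `M f → N f` induced by a linear map `M → N`. -/
def cornerMap (φ : M →ₗ[Aᵐᵒᵖ] N) :
    cornerPart f M →ₗ[(hf.Corner)ᵐᵒᵖ] cornerPart f N where
  toFun m := ⟨φ m, by
    obtain ⟨n, hn⟩ := m.2
    exact ⟨φ n, by rw [hn, map_smul]⟩⟩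
  map_add' m n := Subtype.ext (map_add φ _ _)
  map_smul' c m := Subtype.ext (map_smul φ _ _)

/-- Taking kernels commutes with `M ↦ M f`. -/
def cornerKerEquiv (φ : M →ₗ[Aᵐᵒᵖ] N) :
    LinearMap.ker (cornerMap hf φ) ≃ₗ[(hf.Corner)ᵐᵒᵖ] cornerPart f (LinearMap.ker φ) where
  toFun m := ⟨⟨m.1.1, congrArg Subtype.val m.2⟩, (mem_cornerPart_iff hf).mpr
    (Subtype.ext ((mem_cornerPart_iff hf).mp m.1.2))⟩
  invFun m := ⟨⟨m.1.1, (mem_cornerPart_iff hf).mpr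
    (congrArg Subtype.val ((mem_cornerPart_iff hf).mp m.2))⟩, Subtype.ext m.1.2⟩
  map_add' _ _ := rfl
  map_smul' _ _ := rfl
  left_inv _ := rfl
  right_inv _ := rfl

/-- If `R` is a direct sum of copies of `fA`, then `R f` is even a free module over `fAf`. -/
lemma projective_cornerPart_finsupp (ι : Type u) :
    Module.Projective (hf.Corner)ᵐᵒᵖ (cornerPart f (ι →₀ rightIdeal f)) := by
  let t : rightIdeal f →+ (hf.Corner)ᵐᵒᵖ :=
    { toFun a := op ⟨(a : A) * f, (Subsemigroup.mem_corner_iff hf).mpr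
        ⟨by rw [← mul_assoc, (mem_rightIdeal_iff hf).mp a.2], by rw [mul_assoc, hf.eq]⟩⟩
      map_zero' := congrArg op (Subtype.ext (zero_mul f))
      map_add' a b := congrArg op (Subtype.ext (add_mul (a : A) b f)) }
  have hcoord : ∀ (x : cornerPart f (ι →₀ rightIdeal f)) (a : ι),
      ((x.1 a : rightIdeal f) : A) * f = (x.1 a : rightIdeal f) := by
    intro x a
    exact congrArg (fun y : ι →₀ rightIdeal f => ((y a : rightIdeal f) : A))
      ((mem_cornerPart_iff hf).mp x.2)
  let Φ : cornerPart f (ι →₀ rightIdeal f) →ₗ[(hf.Corner)ᵐᵒᵖ] (ι →₀ (hf.Corner)ᵐᵒᵖ) :=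
    { toFun x := Finsupp.mapRange t t.map_zero x.1
      map_add' x y := Finsupp.mapRange_add (t.map_add) x.1 y.1
      map_smul' c x := by
        ext a
        apply unop_injective
        apply Subtype.ext
        change ((x.1 a : rightIdeal f) : A) * c.unop.1 * f =
          ((x.1 a : rightIdeal f) : A) * f * c.unop.1
        rw [hcoord, mul_assoc, ((Subsemigroup.mem_corner_iff hf).mp c.unop.2).2] }
  have hΦ : Function.Bijective Φ := by
    constructor
    · intro x y hxy
      apply Subtype.ext
      ext a
      have h := congrArg (fun z : ι →₀ (hf.Corner)ᵐᵒᵖ => ((z a).unop.1 : A)) hxy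
      change ((x.1 a : rightIdeal f) : A) * f = ((y.1 a : rightIdeal f) : A) * f at h
      rwa [hcoord, hcoord] at h
    · intro y
      let t' : (hf.Corner)ᵐᵒᵖ → rightIdeal f := fun c => ⟨c.unop.1,
        (mem_rightIdeal_iff hf).mpr ((Subsemigroup.mem_corner_iff hf).mp c.unop.2).1⟩
      refine ⟨⟨Finsupp.mapRange t' rfl y, (mem_cornerPart_iff hf).mpr ?_⟩, ?_⟩
      · ext a
        exact ((Subsemigroup.mem_corner_iff hf).mp (y a).unop.2).2
      · ext a
        apply unop_injective
        apply Subtype.ext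
        exact ((Subsemigroup.mem_corner_iff hf).mp (y a).unop.2).2
  exact Module.Projective.of_equiv (LinearEquiv.ofBijective Φ hΦ).symm

/-- The canonical map to a right module `Z` from the direct sum of copies of `fA` indexed by
the elements of `Z f`. -/
noncomputable def cornerCover (f : A) (Z : Type u) [AddCommGroup Z] [Module Aᵐᵒᵖ Z] :
    (cornerPart f Z →₀ rightIdeal f) →ₗ[Aᵐᵒᵖ] Z :=
  Finsupp.lsum ℕ fun z => rightIdealLift f (z : Z)

lemma cornerCover_single {Z : Type u} [AddCommGroup Z] [Module Aᵐᵒᵖ Z] (z : cornerPart f Z)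
    (a : rightIdeal f) : cornerCover f Z (Finsupp.single z a) = op (a : A) • (z : Z) := by
  simp [cornerCover, rightIdealLift_apply]

lemma cornerCover_single_one {Z : Type u} [AddCommGroup Z] [Module Aᵐᵒᵖ Z]
    (hf : IsIdempotentElem f) (z : cornerPart f Z) :
    cornerCover f Z (Finsupp.single z (rightIdealOne f)) = z := by
  rw [cornerCover_single]
  exact (mem_cornerPart_iff hf).mp z.2

lemma cornerMap_cornerCover_surjective (Z : Type u) [AddCommGroup Z] [Module Aᵐᵒᵖ Z] :
    Function.Surjective
      (cornerMap (M := cornerPart f Z →₀ rightIdeal f) hf (cornerCover f Z)) := by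
  intro z
  refine ⟨⟨Finsupp.single z (rightIdealOne f), (mem_cornerPart_iff hf).mpr ?_⟩,
    Subtype.ext (cornerCover_single_one hf z)⟩
  rw [Finsupp.smul_single]
  exact congrArg _ (smul_rightIdealOne hf (rightIdealOne f))

/-- A direct sum of copies of `fA` has no nonzero map to a module `S` with `S f = 0`. -/
lemma hom_finsupp_rightIdeal_eq_zero {ι S : Type u} [AddCommGroup S] [Module Aᵐᵒᵖ S]
    (hf : IsIdempotentElem f) (hS : ∀ s : S, op f • s = 0)
    (φ : (ι →₀ rightIdeal f) →ₗ[Aᵐᵒᵖ] S) : φ = 0 := by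
  ext i a
  have h : φ (Finsupp.single i a) = op (a : A) • op f • φ (Finsupp.single i (rightIdealOne f)) := by
    rw [← map_smul, ← map_smul, Finsupp.smul_single, Finsupp.smul_single, smul_smul, ← op_mul,
      (mem_rightIdeal_iff hf).mp a.2, smul_rightIdealOne hf]
  simp only [LinearMap.comp_apply, Finsupp.lsingle_apply, LinearMap.zero_apply]
  rw [h, hS, smul_zero]

/-- The projection `M → M f` given by the action of `f`. -/
def cornerProj (f : A) (M : Type u) [AddCommGroup M] [Module Aᵐᵒᵖ M] : M →+ cornerPart f M where
  toFun m := ⟨op f • m, smul_mem_cornerPart m⟩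
  map_zero' := Subtype.ext (smul_zero _)
  map_add' _ _ := Subtype.ext (smul_add _ _ _)

lemma cornerProj_coe (hf : IsIdempotentElem f) (z : cornerPart f M) : cornerProj f M z = z :=
  Subtype.ext ((mem_cornerPart_iff hf).mp z.2)

lemma projective_finsupp_rightIdeal (hf : IsIdempotentElem f) (ι : Type u) :
    Module.Projective Aᵐᵒᵖ (ι →₀ rightIdeal f) := by
  classical
  have : Module.Projective Aᵐᵒᵖ (rightIdeal f) := projective_rightIdeal hf
  exact Module.Projective.of_equiv (finsuppLequivDFinsupp Aᵐᵒᵖ).symm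

/-- Let `s` be a section of `R f → Z f` that extends to an idempotent endomorphism `g` of the
projective module `R`.  The image of `g` is projective and maps isomorphically to `Z` after
applying `M ↦ M f`. -/
lemma range_cover (hf : IsIdempotentElem f) {R Z : Type u} [AddCommGroup R] [Module Aᵐᵒᵖ R]
    [AddCommGroup Z] [Module Aᵐᵒᵖ Z] (hR : Module.Projective Aᵐᵒᵖ R)
    (hhom : ∀ (S : Type u) [AddCommGroup S] [Module Aᵐᵒᵖ S], (∀ s : S, op f • s = 0) →
      ∀ φ : R →ₗ[Aᵐᵒᵖ] S, φ = 0) {p : R →ₗ[Aᵐᵒᵖ] Z} {g : R →ₗ[Aᵐᵒᵖ] R}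
    {s : cornerPart f Z → cornerPart f R} (hs0 : s 0 = 0)
    (hps : ∀ z : cornerPart f Z, p (s z : R) = z)
    (hpg : ∀ x, p (g x) = p x) (hgg : ∀ x, g (g x) = g x)
    (hgs : ∀ x, g (op f • x) = s (cornerProj f Z (p x))) :
    ∃ (P : Type u) (_ : AddCommGroup P) (_ : Module Aᵐᵒᵖ P) (π : P →ₗ[Aᵐᵒᵖ] Z),
      Module.Projective Aᵐᵒᵖ P ∧ (∀ z, op f • z ∈ LinearMap.range π) ∧
      (∀ (S : Type u) [AddCommGroup S] [Module Aᵐᵒᵖ S], (∀ s : S, op f • s = 0) →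
        ∀ φ : P →ₗ[Aᵐᵒᵖ] S, φ = 0) ∧
      Subsingleton (cornerPart f (LinearMap.ker π)) := by
  have hgr : ∀ x : LinearMap.range g, g x = x := by
    rintro ⟨_, x, rfl⟩
    exact hgg x
  refine ⟨LinearMap.range g, inferInstance, inferInstance,
    p ∘ₗ (LinearMap.range g).subtype, ?_, ?_, ?_, ?_⟩
  · refine Module.Projective.of_split (LinearMap.range g).subtype g.rangeRestrict ?_
    ext1 x
    exact Subtype.ext (hgr x)
  · intro z
    exact ⟨⟨_, LinearMap.mem_range_self g (s (cornerProj f Z z) : R)⟩, (hpg _).trans (hps _)⟩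
  · intro S _ _ hS φ
    have h := hhom S hS (φ ∘ₗ g.rangeRestrict)
    ext x
    obtain ⟨y, rfl⟩ := g.surjective_rangeRestrict x
    exact LinearMap.congr_fun h y
  · refine subsingleton_of_forall_eq 0 fun x => ?_
    have hx : op f • x.1.1.1 = x.1.1.1 :=
      congrArg (fun y => y.1.1) ((mem_cornerPart_iff hf).mp x.2)
    have hpx : p x.1.1.1 = 0 := x.1.2
    have h := hgs x.1.1.1
    rw [hx, hgr, hpx, map_zero, hs0] at h
    exact Subtype.ext (Subtype.ext (Subtype.ext h))

/-- If `Z f` is projective over `fAf`, there is a projective module generated by `f` that maps to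
`Z`, isomorphically after applying `M ↦ M f`.  A section `s` of `R f → Z f`, for the canonical
cover `R → Z`, extends to an idempotent endomorphism of `R`; its image is the module sought. -/
lemma exists_cover_of_projective (Z : Type u) [AddCommGroup Z] [Module Aᵐᵒᵖ Z]
    (hZ : Module.Projective (hf.Corner)ᵐᵒᵖ (cornerPart f Z)) :
    ∃ (P : Type u) (_ : AddCommGroup P) (_ : Module Aᵐᵒᵖ P) (π : P →ₗ[Aᵐᵒᵖ] Z),
      Module.Projective Aᵐᵒᵖ P ∧ (∀ z, op f • z ∈ LinearMap.range π) ∧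
      (∀ (S : Type u) [AddCommGroup S] [Module Aᵐᵒᵖ S], (∀ s : S, op f • s = 0) →
        ∀ φ : P →ₗ[Aᵐᵒᵖ] S, φ = 0) ∧
      Subsingleton (cornerPart f (LinearMap.ker π)) := by
  obtain ⟨s, hs⟩ := Module.projective_lifting_property
    (cornerMap (M := cornerPart f Z →₀ rightIdeal f) hf (cornerCover f Z)) LinearMap.id
    (cornerMap_cornerCover_surjective hf Z)
  have hps : ∀ z : cornerPart f Z, cornerCover f Z (s z).1 = z := fun z =>
    congrArg Subtype.val (LinearMap.congr_fun hs z)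
  let g : (cornerPart f Z →₀ rightIdeal f) →ₗ[Aᵐᵒᵖ] (cornerPart f Z →₀ rightIdeal f) :=
    Finsupp.lsum ℕ fun z => rightIdealLift f (s z).1
  have hg : ∀ z a, g (Finsupp.single z a) = op (a : A) • (s z).1 := fun z a =>
    (Finsupp.lsum_single ℕ _ z a).trans (rightIdealLift_apply f _ a)
  have hpg : ∀ x, cornerCover f Z (g x) = cornerCover f Z x := by
    intro x
    refine LinearMap.congr_fun (f := cornerCover f Z ∘ₗ g) ?_ x
    apply Finsupp.lhom_ext
    intro z a
    rw [LinearMap.comp_apply, hg, map_smul, hps, cornerCover_single]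
  -- On `R f` the endomorphism `g` is `s` composed with the cover.
  have hgs : ∀ x, g (op f • x) = (s (cornerProj f Z (cornerCover f Z x))).1 := by
    intro x
    induction x using Finsupp.induction_linear with
    | zero => simp only [smul_zero, map_zero]; rfl
    | add x y hx hy => simp only [smul_add, map_add, hx, hy]; rfl
    | single z a =>
      let c : hf.Corner := ⟨(a : A) * f, (Subsemigroup.mem_corner_iff hf).mpr
        ⟨by rw [← mul_assoc, (mem_rightIdeal_iff hf).mp a.2], by rw [mul_assoc, hf.eq]⟩⟩
      have hc : cornerProj f Z (cornerCover f Z (Finsupp.single z a)) = op c • z := by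
        rw [cornerCover_single]
        apply Subtype.ext
        change op f • op (a : A) • (z : Z) = op ((a : A) * f) • (z : Z)
        rw [op_mul, mul_smul]
      rw [hc, map_smul, map_smul, hg, smul_smul, ← op_mul]
      rfl
  have hgsz : ∀ z : cornerPart f Z, g (s z).1 = (s z).1 := by
    intro z
    have h1 := hgs (s z).1
    rwa [(mem_cornerPart_iff hf).mp (s z).2, hps, cornerProj_coe hf] at h1
  have hgg : ∀ x, g (g x) = g x := by
    intro x
    refine LinearMap.congr_fun (f := g ∘ₗ g) ?_ x
    apply Finsupp.lhom_ext
    intro z a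
    rw [LinearMap.comp_apply, hg, map_smul, hgsz]
  exact range_cover (R := cornerPart f Z →₀ rightIdeal f) hf (projective_finsupp_rightIdeal hf _)
    (fun S _ _ hS φ => hom_finsupp_rightIdeal_eq_zero hf hS φ) (map_zero s) hps hpg hgg hgs

lemma hasProjectiveDimensionLT_cornerPart_ker (φ : M →ₗ[Aᵐᵒᵖ] N)
    (hφ : Function.Surjective (cornerMap hf φ))
    (hM : Module.Projective (hf.Corner)ᵐᵒᵖ (cornerPart f M)) (d : ℕ)
    (hN : HasProjectiveDimensionLT (ModuleCat.of (hf.Corner)ᵐᵒᵖ (cornerPart f N)) (d + 2)) :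
    HasProjectiveDimensionLT
      (ModuleCat.of (hf.Corner)ᵐᵒᵖ (cornerPart f (LinearMap.ker φ))) (d + 1) := by
  have hproj := (IsProjective.iff_projective _).mp hM
  have hker := ((LinearMap.shortExact_shortComplexKer hφ).hasProjectiveDimensionLT_X₃_iff d
    hproj).mp hN
  have i : ModuleCat.of (hf.Corner)ᵐᵒᵖ (LinearMap.ker (cornerMap hf φ)) ≅
      ModuleCat.of (hf.Corner)ᵐᵒᵖ (cornerPart f (LinearMap.ker φ)) :=
    LinearEquiv.toModuleIso (cornerKerEquiv hf φ)
  exact hasProjectiveDimensionLT_of_iso i _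

/-- A module `Z` admits a map from a projective module generated by `f` whose image contains
`Z f`, and whose kernel `K` is such that the projective dimension of `K f` over `fAf` is smaller
than that of `Z f`.  Here the zero module counts as having dimension less than `0`. -/
lemma exists_cover (Z : Type u) [AddCommGroup Z] [Module Aᵐᵒᵖ Z] (d : ℕ)
    (hZ : HasProjectiveDimensionLT (ModuleCat.of (hf.Corner)ᵐᵒᵖ (cornerPart f Z)) (d + 1)) :
    ∃ (P : Type u) (_ : AddCommGroup P) (_ : Module Aᵐᵒᵖ P) (π : P →ₗ[Aᵐᵒᵖ] Z),
      Module.Projective Aᵐᵒᵖ P ∧ (∀ z, op f • z ∈ LinearMap.range π) ∧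
      (∀ (S : Type u) [AddCommGroup S] [Module Aᵐᵒᵖ S], (∀ s : S, op f • s = 0) →
        ∀ φ : P →ₗ[Aᵐᵒᵖ] S, φ = 0) ∧
      HasProjectiveDimensionLT
        (ModuleCat.of (hf.Corner)ᵐᵒᵖ (cornerPart f (LinearMap.ker π))) d := by
  cases d with
  | zero =>
    have hZ' : Module.Projective (hf.Corner)ᵐᵒᵖ (cornerPart f Z) :=
      (IsProjective.iff_projective (R := (hf.Corner)ᵐᵒᵖ) (P := cornerPart f Z)).mpr
        (projective_iff_hasProjectiveDimensionLT_one.mpr hZ)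
    obtain ⟨P, _, _, π, h1, h2, h3, h4⟩ := exists_cover_of_projective hf Z hZ'
    refine ⟨P, _, _, π, h1, h2, h3, Limits.IsZero.hasProjectiveDimensionLT_zero ?_⟩
    exact ModuleCat.isZero_of_subsingleton _
  | succ d =>
    refine ⟨cornerPart f Z →₀ rightIdeal f, inferInstance, inferInstance, cornerCover f Z,
      projective_finsupp_rightIdeal hf _,
      fun z => ⟨_, cornerCover_single_one hf ⟨_, smul_mem_cornerPart z⟩⟩,
      fun S _ _ hS φ => hom_finsupp_rightIdeal_eq_zero hf hS φ, ?_⟩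
    have hp := cornerMap_cornerCover_surjective hf Z
    exact hasProjectiveDimensionLT_cornerPart_ker hf _ hp
      (projective_cornerPart_finsupp hf (cornerPart f Z)) d hZ

end Corner

/-! ### Propagating the vanishing of `Ext` along syzygies -/

/-- Let `S f = 0`, let every module killed by `f` be a direct sum of copies of `S`, and let `m` be
the largest degree in which `Ext(S, S)` does not vanish.  If the projective dimension of `Z f` is
finite and `Ext^j(Z, S) = 0` for all `j ≥ m`, then `Ext(Z, S) = 0`. -/
lemma extVanishes_of_cornerPart {A : Type u} [Ring A] {f : A} (hf : IsIdempotentElem f)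
    {S : Type u} [AddCommGroup S] [Module Aᵐᵒᵖ S] (hS : ∀ s : S, op f • s = 0)
    (hsum : ∀ (H : Type u) [AddCommGroup H] [Module Aᵐᵒᵖ H], (∀ x : H, op f • x = 0) →
      ∃ ι : Type u, Nonempty (H ≃ₗ[Aᵐᵒᵖ] ι →₀ S))
    {m : ℕ} (hm : ¬ ExtVanishes Aᵐᵒᵖ S S m) (hm' : ∀ j, m < j → ExtVanishes Aᵐᵒᵖ S S j)
    (d : ℕ) (Z : Type u) [AddCommGroup Z] [Module Aᵐᵒᵖ Z]
    (hZ : HasProjectiveDimensionLT (ModuleCat.of (hf.Corner)ᵐᵒᵖ (cornerPart f Z)) d)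
    (hZS : ∀ j, m ≤ j → ExtVanishes Aᵐᵒᵖ Z S j) (j : ℕ) : ExtVanishes Aᵐᵒᵖ Z S j := by
  -- The modules `H` killed by `f` have no `Ext` into `S` above degree `m`, and are zero
  -- if they have none in degree `m`.
  have hH : ∀ (H : Type u) [AddCommGroup H] [Module Aᵐᵒᵖ H], (∀ x : H, op f • x = 0) →
      (∀ j, m < j → ExtVanishes Aᵐᵒᵖ H S j) ∧ (ExtVanishes Aᵐᵒᵖ H S m → Subsingleton H) := by
    intro H _ _ hHf
    obtain ⟨ι, ⟨φ⟩⟩ := hsum H hHf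
    refine ⟨fun j hj => (ExtVanishes.finsupp ι (hm' j hj)).of_linearEquiv φ, fun h => ?_⟩
    rcases isEmpty_or_nonempty ι with hι | ⟨⟨a⟩⟩
    · exact φ.toEquiv.subsingleton
    · exact absurd ((h.of_linearEquiv φ.symm).of_retract (Finsupp.lsingle a) (Finsupp.lapply a)
        (LinearMap.ext fun x => Finsupp.single_eq_same)) hm
  induction d generalizing Z j with
  | zero =>
    have hZ0 := ModuleCat.subsingleton_of_isZero (isZero_of_hasProjectiveDimensionLT_zero
      (ModuleCat.of (hf.Corner)ᵐᵒᵖ (cornerPart f Z)))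
    have hZf : ∀ z : Z, op f • z = 0 := fun z =>
      congrArg Subtype.val (Subsingleton.elim (α := cornerPart f Z) (cornerProj f Z z) 0)
    have := (hH Z hZf).2 (hZS m le_rfl)
    exact ExtVanishes.of_subsingleton
  | succ d ih =>
    obtain ⟨P, _, _, π, hP, hrange, hPS, hd⟩ := exists_cover hf Z d hZ
    have hquot : ∀ x : Z ⧸ LinearMap.range π, op f • x = 0 := by
      intro x
      obtain ⟨z, rfl⟩ := Submodule.mkQ_surjective _ x
      rw [← map_smul]
      exact (Submodule.Quotient.mk_eq_zero _).mpr (hrange z)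
    have hq := Submodule.mkQ_surjective (LinearMap.range π)
    let κ : LinearMap.ker (LinearMap.range π).mkQ ≃ₗ[Aᵐᵒᵖ] LinearMap.range π :=
      LinearEquiv.ofEq _ _ (Submodule.ker_mkQ _)
    have hr := π.surjective_rangeRestrict
    let κ' : LinearMap.ker π.rangeRestrict ≃ₗ[Aᵐᵒᵖ] LinearMap.ker π :=
      LinearEquiv.ofEq _ _ π.ker_rangeRestrict
    have hPall : ∀ j, ExtVanishes Aᵐᵒᵖ P S j := by
      intro j
      cases j with
      | zero => exact ExtVanishes.zero_iff.mpr (hPS S hS)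
      | succ j => exact ExtVanishes.of_projective
    have hB : ∀ j, m ≤ j → ExtVanishes Aᵐᵒᵖ (LinearMap.range π) S j := fun j hj =>
      ((hZS j hj).ker hq ((hH _ hquot).1 (j + 1) (by omega))).of_linearEquiv κ.symm
    have hK : ∀ j, ExtVanishes Aᵐᵒᵖ (LinearMap.ker π) S j := ih _ hd fun j hj =>
      ((hPall j).ker hr (hB (j + 1) (by omega))).of_linearEquiv κ'.symm
    have hB' : ∀ j, ExtVanishes Aᵐᵒᵖ (LinearMap.range π) S j := fun j =>
      ExtVanishes.target hr (fun i => (hK i).of_linearEquiv κ') (hPall j)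
    have hQ : Subsingleton (Z ⧸ LinearMap.range π) := (hH _ hquot).2
      (ExtVanishes.target hq (fun i => (hB' i).of_linearEquiv κ) (hZS m le_rfl))
    exact ExtVanishes.middle hq ((hB' j).of_linearEquiv κ) ExtVanishes.of_subsingleton

/-! ### Simple modules over a semiperfect ring -/

section Semiperfect

variable {A : Type u} [Ring A]

lemma exists_mul_one_sub_eq_one {r : A} (hr : r ∈ Ring.jacobson A) :
    ∃ z : A, z * (1 - r) = 1 := by
  have h : Ideal.span {1 - r} = ⊤ := by
    by_contra h
    obtain ⟨m, hm, hle⟩ := Ideal.exists_le_maximal _ h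
    refine hm.ne_top ((Ideal.eq_top_iff_one m).mpr ?_)
    have h1 : 1 - r ∈ m := hle (Ideal.subset_span rfl)
    simpa using m.add_mem h1 (Ring.jacobson_le_of_isMaximal m hr)
  exact Ideal.mem_span_singleton'.mp ((Ideal.eq_top_iff_one _).mp h)

lemma isUnit_one_sub_of_mem_jacobson {r : A} (hr : r ∈ Ring.jacobson A) : IsUnit (1 - r) := by
  obtain ⟨z, hz⟩ := exists_mul_one_sub_eq_one hr
  obtain ⟨w, hw⟩ := exists_mul_one_sub_eq_one (neg_mem (Ideal.mul_mem_left _ z hr))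
  have hz' : z = 1 - -(z * r) := by
    rw [mul_sub, mul_one] at hz
    rw [sub_neg_eq_add, ← hz, sub_add_cancel]
  rw [← hz'] at hw
  rw [left_inv_eq_right_inv hw hz] at hw
  exact ⟨⟨1 - r, z, hw, hz⟩, rfl⟩

lemma eq_zero_of_isIdempotentElem_of_mem_jacobson {g : A} (hg : IsIdempotentElem g)
    (h : g ∈ Ring.jacobson A) : g = 0 := by
  refine (isUnit_one_sub_of_mem_jacobson h).mul_left_cancel ?_
  rw [sub_mul, one_mul, hg.eq, sub_self, mul_zero]

/-- The radical acts as zero on every simple right module.  It is defined through left ideals; what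
makes the argument symmetric is that `1 - r` is invertible for `r` in the radical. -/
lemma smul_eq_zero_of_isSimpleModule {X : Type u} [AddCommGroup X] [Module Aᵐᵒᵖ X]
    [IsSimpleModule Aᵐᵒᵖ X] {r : A} (hr : r ∈ Ring.jacobson A) (x : X) : op r • x = 0 := by
  by_contra hx
  obtain ⟨a, ha⟩ := IsSimpleModule.toSpanSingleton_surjective Aᵐᵒᵖ hx x
  rw [LinearMap.toSpanSingleton_apply, smul_smul, ← op_unop a, ← op_mul] at ha
  obtain ⟨u, hu⟩ := isUnit_one_sub_of_mem_jacobson (Ideal.mul_mem_right a.unop _ hr)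
  have h : op (u : A) • x = 0 := by
    rw [hu]
    exact (sub_smul (1 : Aᵐᵒᵖ) (op (r * a.unop)) x).trans (by rw [ha, one_smul, sub_self])
  have hx0 : x = 0 := by
    have := congrArg (fun y => op ((u⁻¹ : Aˣ) : A) • y) h
    simpa only [smul_smul, ← op_mul, Units.mul_inv, op_one, one_smul, smul_zero] using this
  exact hx (by rw [hx0, smul_zero])

/-- A semisimple ring is von Neumann regular. -/
lemma exists_mul_mul_eq_self_of_isSemisimpleRing {B : Type u} [Ring B] [IsSemisimpleRing B]
    (x : B) : ∃ y, x * y * x = x := by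
  obtain ⟨C, hC⟩ := exists_isCompl (Ideal.span {x})
  obtain ⟨a, ha, c, hc, hac⟩ := Submodule.mem_sup.mp
    (hC.sup_eq_top ▸ Submodule.mem_top : (1 : B) ∈ Ideal.span {x} ⊔ C)
  obtain ⟨y, rfl⟩ := Ideal.mem_span_singleton'.mp ha
  refine ⟨y, ?_⟩
  have h1 : x * c = x - x * y * x := by
    rw [← eq_sub_iff_add_eq'] at hac
    rw [hac]; noncomm_ring
  have h2 : x * c ∈ Ideal.span {x} ⊓ C := by
    refine ⟨?_, Ideal.mul_mem_left _ _ hc⟩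
    rw [h1]
    exact sub_mem (Ideal.subset_span rfl) (Ideal.mul_mem_left _ _ (Ideal.subset_span rfl))
  rw [hC.inf_eq_bot, Submodule.mem_bot, h1] at h2
  exact (sub_eq_zero.mp h2).symm

/-- For a primitive idempotent `e`, an element of `eAe` that is idempotent modulo the radical, and
not in the radical, is congruent to `e`. -/
lemma IsPrimitiveIdempotent.sub_mem_jacobson (hsemi : IsSemiperfectRing A) {e : A}
    (he : IsPrimitiveIdempotent e) {t : A} (het : e * t = t) (hte : t * e = t)
    (ht : t * t - t ∈ Ring.jacobson A) (ht0 : t ∉ Ring.jacobson A) :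
    e - t ∈ Ring.jacobson A := by
  obtain ⟨g, hg, hgt⟩ := hsemi.exists_lift t ht
  have hge : g * e - g ∈ Ring.jacobson A := by
    have h : g * e - g = (g - t) * e - (g - t) := by rw [sub_mul, hte]; abel
    rw [h]
    exact sub_mem (Ideal.mul_mem_right _ _ hgt) hgt
  -- Conjugating `g` by the unit `u = 1 - g + g e` makes it absorb `e` on the right.
  obtain ⟨u, hu⟩ := isUnit_one_sub_of_mem_jacobson (neg_mem hge)
  have hgu : g * u = g * e := by
    rw [hu]
    have : g * (1 - -(g * e - g)) = g + g * g * e - g * g := by noncomm_ring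
    rw [this, hg.eq]; abel
  let h : A := (u⁻¹ : Aˣ) * g * u
  have hhe : h * e = h := by
    change ((u⁻¹ : Aˣ) : A) * g * u * e = (u⁻¹ : Aˣ) * g * u
    rw [mul_assoc _ g, hgu, mul_assoc, mul_assoc g, he.isIdempotentElem.eq]
  have hhh : h * h = h := by
    change ((u⁻¹ : Aˣ) : A) * g * u * ((u⁻¹ : Aˣ) * g * u) = (u⁻¹ : Aˣ) * g * u
    calc _ = ((u⁻¹ : Aˣ) : A) * g * (u * (u⁻¹ : Aˣ)) * g * u := by noncomm_ring
      _ = _ := by rw [Units.mul_inv, mul_one, mul_assoc _ g g, hg.eq]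
  have hhg : h - g ∈ Ring.jacobson A := by
    have h1 : h - g = (u⁻¹ : Aˣ) * ((g * e - g) - (g * e - g) * g) := by
      have h2 : (u : A) * (h - g) = (g * e - g) - (g * e - g) * g := by
        have h3 : (u : A) * h = g * u := by
          change (u : A) * ((u⁻¹ : Aˣ) * g * u) = g * u
          rw [← mul_assoc, ← mul_assoc, Units.mul_inv, one_mul]
        rw [mul_sub, h3, hgu, hu]; noncomm_ring
      rw [← h2, ← mul_assoc, Units.inv_mul, one_mul]
    rw [h1]
    exact Ideal.mul_mem_left _ _ (sub_mem hge (Ideal.mul_mem_right _ _ hge))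
  have hht : h - t ∈ Ring.jacobson A := by
    have := add_mem hhg hgt
    rwa [sub_add_sub_cancel] at this
  have hee := he.isIdempotentElem.eq
  have hidem : IsIdempotentElem (e * h) := by
    change e * h * (e * h) = e * h
    rw [mul_assoc, ← mul_assoc h, hhe, hhh]
  have heht : e * h - t ∈ Ring.jacobson A := by
    have := Ideal.mul_mem_left _ e hht
    rwa [mul_sub, het] at this
  have key := he.eq_zero_or_eq_zero (e * h) (e - e * h) hidem
    (by
      change (e - e * h) * (e - e * h) = e - e * h
      have h1 : e * h * e = e * h := by rw [mul_assoc, hhe]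
      have h2 : e * (e * h) = e * h := by rw [← mul_assoc, hee]
      rw [sub_mul, mul_sub, mul_sub, hee, h1, h2, hidem.eq]; abel)
    (by rw [mul_sub, hidem.eq, mul_assoc, hhe, sub_self])
    (by rw [sub_mul, hidem.eq, ← mul_assoc, hee, sub_self])
    (by abel)
  rcases key with h0 | h0
  · rw [h0, zero_sub] at heht
    exact absurd (neg_mem_iff.mp heht) ht0
  · rwa [← sub_eq_zero.mp h0] at heht

lemma mem_rightIdealRad_iff {e : A} {x : rightIdeal e} (he : IsIdempotentElem e) :
    x ∈ rightIdealRad e ↔ (x : A) ∈ Ring.jacobson A := by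
  constructor
  · rintro ⟨r, hr, hx⟩
    rw [hx]
    exact Ideal.mul_mem_left _ _ hr
  · intro h
    exact ⟨x, h, ((mem_rightIdeal_iff he).mp x.2).symm⟩

lemma smul_topAt_eq_zero {e r : A} (he : IsIdempotentElem e) (hr : r ∈ Ring.jacobson A)
    (x : topAt e) : op r • x = 0 := by
  obtain ⟨y, rfl⟩ := Submodule.mkQ_surjective _ x
  rw [← map_smul]
  exact (Submodule.Quotient.mk_eq_zero _).mpr
    ((mem_rightIdealRad_iff he).mpr (Ideal.mul_mem_left _ _ hr))

/-- The image of `e` in `S_e`. -/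
def topAtOne (e : A) : topAt e := (rightIdealRad e).mkQ (rightIdealOne e)

lemma topAtOne_ne_zero {e : A} (he : IsPrimitiveIdempotent e) : topAtOne e ≠ 0 := fun h =>
  he.ne_zero (eq_zero_of_isIdempotentElem_of_mem_jacobson he.isIdempotentElem
    ((mem_rightIdealRad_iff he.isIdempotentElem).mp ((Submodule.Quotient.mk_eq_zero _).mp h)))

lemma isSimpleModule_topAt (hsemi : IsSemiperfectRing A) {e : A}
    (he : IsPrimitiveIdempotent e) : IsSimpleModule Aᵐᵒᵖ (topAt e) := by
  have hee := he.isIdempotentElem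
  rw [isSimpleModule_iff_toSpanSingleton_surjective]
  refine ⟨⟨_, _, topAtOne_ne_zero he⟩, fun x hx s => ?_⟩
  obtain ⟨x, rfl⟩ := Submodule.mkQ_surjective _ x
  obtain ⟨s, rfl⟩ := Submodule.mkQ_surjective _ s
  have hxJ : (x : A) ∉ Ring.jacobson A := fun h =>
    hx ((Submodule.Quotient.mk_eq_zero _).mpr ((mem_rightIdealRad_iff hee).mpr h))
  have hex : e * (x : A) = x := (mem_rightIdeal_iff hee).mp x.2
  have := hsemi.isSemisimpleRing
  -- If `x y x ≡ x`, then `x y e ∈ eAe` is idempotent modulo the radical, so it is `≡ e`.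
  obtain ⟨y, hy⟩ := exists_mul_mul_eq_self_of_isSemisimpleRing
    (Ideal.Quotient.mk (Ring.jacobson A) (x : A))
  obtain ⟨y, rfl⟩ := Ideal.Quotient.mk_surjective y
  rw [← map_mul, ← map_mul, Ideal.Quotient.eq] at hy
  have h1 : e - x * y * e ∈ Ring.jacobson A := by
    refine he.sub_mem_jacobson hsemi ?_ ?_ ?_ ?_
    · rw [← mul_assoc, ← mul_assoc, hex]
    · rw [mul_assoc, hee.eq]
    · have h2 : (x : A) * y * e * (x * y * e) - x * y * e = (x * y * x - x) * (y * e) := by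
        calc (x : A) * y * e * (x * y * e) - x * y * e
            = x * y * (e * x) * y * e - x * y * e := by noncomm_ring
          _ = (x * y * x - x) * (y * e) := by rw [hex]; noncomm_ring
      rw [h2]
      exact Ideal.mul_mem_right _ _ hy
    · intro h
      have h3 : (x : A) * y * e * x ∈ Ring.jacobson A := Ideal.mul_mem_right _ _ h
      rw [mul_assoc _ e, hex] at h3
      exact hxJ (by simpa using sub_mem h3 hy)
  refine ⟨op (y * s), ?_⟩
  rw [LinearMap.toSpanSingleton_apply, ← map_smul]
  refine (Submodule.Quotient.eq _).mpr ((mem_rightIdealRad_iff hee).mpr ?_)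
  change (x : A) * (y * s) - s ∈ Ring.jacobson A
  have h4 := neg_mem (Ideal.mul_mem_right (s : A) _ h1)
  have hes : e * (s : A) = s := (mem_rightIdeal_iff hee).mp s.2
  have h5 : -((e - x * y * e) * (s : A)) = x * (y * s) - s := by
    calc -((e - x * y * e) * (s : A)) = x * y * (e * s) - e * s := by noncomm_ring
      _ = x * (y * s) - s := by rw [hes, mul_assoc]
  rwa [h5] at h4

/-- An element `x` of a right module annihilated by `e rad A` and with `x e = x` is the
image of the class of `e` under a linear map from `S_e`. -/
lemma exists_topAt_lift {e : A} {X : Type u} [AddCommGroup X] [Module Aᵐᵒᵖ X]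
    {x : X}
    (hx : op e • x = x) (hJ : ∀ r ∈ Ring.jacobson A, op (e * r) • x = 0) :
    ∃ φ : topAt e →ₗ[Aᵐᵒᵖ] X, φ (topAtOne e) = x := by
  refine ⟨(rightIdealRad e).liftQ (rightIdealLift e x) ?_, hx⟩
  rintro y ⟨r, hr, hy⟩
  rw [LinearMap.mem_ker, rightIdealLift_apply, hy]
  exact hJ r hr

/-- If `eA` is not a direct summand of `fA`, with `f = 1 - e`, then `f` acts as zero on `S_e`:
otherwise some product of an element of `eAf` and one of `fAe` is invertible in `eAe`. -/
lemma smul_one_sub_topAt (hsemi : IsSemiperfectRing A) {e : A} (he : IsPrimitiveIdempotent e)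
    (hbasic : ¬ IsSummandOf Aᵐᵒᵖ (rightIdeal e) (rightIdeal (1 - e))) (s : topAt e) :
    op (1 - e) • s = 0 := by
  have hee := he.isIdempotentElem
  have hff := hee.one_sub
  by_contra hs
  have := isSimpleModule_topAt hsemi he
  obtain ⟨b, hb⟩ := IsSimpleModule.toSpanSingleton_surjective Aᵐᵒᵖ hs (topAtOne e)
  obtain ⟨a, rfl⟩ := Submodule.mkQ_surjective _ s
  rw [LinearMap.toSpanSingleton_apply, ← map_smul, ← map_smul] at hb
  have hr := (mem_rightIdealRad_iff hee).mp ((Submodule.Quotient.eq _).mp hb)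
  change (a : A) * (1 - e) * b.unop - e ∈ Ring.jacobson A at hr
  have hea : e * (a : A) = a := (mem_rightIdeal_iff hee).mp a.2
  set f := 1 - e with hf
  set r := (a : A) * f * b.unop - e with hrdef
  have her : e * r = r := by rw [hrdef, mul_sub, ← mul_assoc, ← mul_assoc, hea, hee.eq]
  obtain ⟨u, hu⟩ := isUnit_one_sub_of_mem_jacobson
    (neg_mem (Ideal.mul_mem_right e _ hr))
  have hue : (u : A) * e = a * f * b.unop * e := by
    rw [hu, sub_neg_eq_add, add_mul, one_mul, mul_assoc r, hee.eq, hrdef, sub_mul, hee.eq]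
    abel
  have heu : e * (u : A) = u * e := by
    rw [hu, sub_neg_eq_add, mul_add, add_mul, ← mul_assoc, her, mul_assoc r, hee.eq, mul_one,
      one_mul]
  have hev : e * ((u⁻¹ : Aˣ) : A) = (u⁻¹ : Aˣ) * e := by
    calc e * ((u⁻¹ : Aˣ) : A) = (u⁻¹ : Aˣ) * (u * e) * (u⁻¹ : Aˣ) := by
          rw [← mul_assoc, Units.inv_mul, one_mul]
      _ = (u⁻¹ : Aˣ) * e := by rw [← heu, mul_assoc, mul_assoc, Units.mul_inv, mul_one]
  let α : rightIdeal e →ₗ[Aᵐᵒᵖ] rightIdeal f :=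
    rightIdealLift e ⟨f * (b.unop * e), _, rfl⟩
  let β : rightIdeal f →ₗ[Aᵐᵒᵖ] rightIdeal e :=
    rightIdealLift f ⟨(u⁻¹ : Aˣ) * (a * f), (mem_rightIdeal_iff hee).mpr (by
      rw [← mul_assoc, hev, mul_assoc, ← mul_assoc e, hea])⟩
  have hβα : ∀ x, β (α x) = x := by
    intro x
    apply Subtype.ext
    change ((u⁻¹ : Aˣ) : A) * (a * f) * (f * (b.unop * e) * x) = x
    calc ((u⁻¹ : Aˣ) : A) * (a * f) * (f * (b.unop * e) * x)
        = (u⁻¹ : Aˣ) * (a * (f * f) * b.unop * e) * x := by noncomm_ring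
      _ = x := by
        rw [hff.eq, ← hue, ← mul_assoc, Units.inv_mul, one_mul,
          (mem_rightIdeal_iff hee).mp x.2]
  have hα : Function.Injective α := Function.LeftInverse.injective hβα
  refine hbasic ⟨LinearMap.range α, LinearMap.ker β, ?_, ⟨LinearEquiv.ofInjective α hα⟩⟩
  constructor
  · rw [Submodule.disjoint_def]
    rintro _ ⟨x, rfl⟩ hx
    rw [LinearMap.mem_ker, hβα] at hx
    rw [hx, map_zero]
  · rw [codisjoint_iff, Submodule.eq_top_iff']
    intro y
    refine Submodule.mem_sup.mpr ⟨α (β y), ⟨_, rfl⟩, y - α (β y), ?_, add_sub_cancel _ _⟩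
    rw [LinearMap.mem_ker, map_sub, hβα, sub_self]

/-! ### Modules killed by `1 - e` -/

lemma op_smul_eq_self_of_one_sub {e : A} {X : Type u} [AddCommGroup X] [Module Aᵐᵒᵖ X] {x : X}
    (hx : op (1 - e) • x = 0) : op e • x = x := by
  have h : op (1 - e) • x = x - op e • x := (sub_smul (1 : Aᵐᵒᵖ) (op e) x).trans (by rw [one_smul])
  rw [h] at hx
  exact (sub_eq_zero.mp hx).symm

lemma nonempty_topAt_equiv_of_isSimpleModule (hsemi : IsSemiperfectRing A) {e : A}
    (he : IsPrimitiveIdempotent e) {X : Type u} [AddCommGroup X] [Module Aᵐᵒᵖ X]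
    [IsSimpleModule Aᵐᵒᵖ X] (hX : ∀ x : X, op (1 - e) • x = 0) :
    Nonempty (topAt e ≃ₗ[Aᵐᵒᵖ] X) := by
  have := isSimpleModule_topAt hsemi he
  have := IsSimpleModule.nontrivial Aᵐᵒᵖ X
  obtain ⟨x, hx⟩ := exists_ne (0 : X)
  obtain ⟨φ, hφ⟩ := exists_topAt_lift (e := e) (op_smul_eq_self_of_one_sub (hX x))
    fun r hr => smul_eq_zero_of_isSimpleModule (Ideal.mul_mem_left _ e hr) x
  refine ⟨LinearEquiv.ofBijective φ (φ.bijective_of_ne_zero ?_)⟩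
  rintro rfl
  exact hx hφ.symm

lemma exists_simple_quotient {R W : Type u} [Ring R] [AddCommGroup W] [Module R W]
    [IsNoetherian R W] (T : Submodule R W) (hT : T ≠ ⊤) :
    ∃ (X : Type u) (_ : AddCommGroup X) (_ : Module R X) (q : W →ₗ[R] X),
      IsSimpleModule R X ∧ Function.Surjective q ∧ ∀ w ∈ T, q w = 0 := by
  obtain ⟨N, hN, hle⟩ := (eq_top_or_exists_le_coatom T).resolve_left hT
  exact ⟨W ⧸ N, inferInstance, inferInstance, N.mkQ, isSimpleModule_iff_isCoatom.mpr hN,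
    N.mkQ_surjective, fun w hw => (Submodule.Quotient.mk_eq_zero N).mpr (hle hw)⟩

/-- If `Ext^1(S_e, S_e) = 0`, then `e rad A` is contained in the two-sided ideal generated by
`f = 1 - e`.  Otherwise `e rad A` has a maximal submodule whose quotient is killed by `f`, hence is
isomorphic to `S_e`; this gives a nonzero map `e rad A → S_e`, but such maps extend to `eA`, and all
maps `eA → S_e` vanish on `e rad A`. -/
lemma mul_mem_span_of_ext_one (hright : IsNoetherianRing Aᵐᵒᵖ) (hsemi : IsSemiperfectRing A)
    {e : A} (he : IsPrimitiveIdempotent e) (hExt : ExtVanishes Aᵐᵒᵖ (topAt e) (topAt e) 1)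
    {r : A} (hr : r ∈ Ring.jacobson A) :
    e * r ∈ Submodule.span Aᵐᵒᵖ (Set.range fun a : A => e * a * (1 - e)) := by
  have hee := he.isIdempotentElem
  have hnoeth : IsNoetherian Aᵐᵒᵖ A := by
    let j : A →ₗ[Aᵐᵒᵖ] Aᵐᵒᵖ :=
      { toFun := op
        map_add' _ _ := rfl
        map_smul' _ _ := rfl }
    exact isNoetherian_of_injective j op_injective
  have hsimple := isSimpleModule_topAt hsemi he
  set T := Submodule.span Aᵐᵒᵖ (Set.range fun a : A => e * a * (1 - e)) with hT
  let T' : Submodule Aᵐᵒᵖ (rightIdealRad e) :=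
    T.comap ((rightIdeal e).subtype ∘ₗ (rightIdealRad e).subtype)
  by_cases htop : T' = ⊤
  · exact (Submodule.eq_top_iff'.mp htop ⟨⟨e * r, r, rfl⟩, r, hr, rfl⟩ :)
  · exfalso
    obtain ⟨X, _, _, q, hX, hq, hqT⟩ := exists_simple_quotient (W := rightIdealRad e) T' htop
    obtain ⟨φ⟩ := nonempty_topAt_equiv_of_isSimpleModule hsemi he (X := X) (by
      intro x
      obtain ⟨w, rfl⟩ := hq x
      rw [← map_smul]
      refine hqT _ (Submodule.subset_span ⟨w.1.1, ?_⟩)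
      change e * (w.1.1 : A) * (1 - e) = w.1.1 * (1 - e)
      rw [(mem_rightIdeal_iff hee).mp w.1.2])
    let κ : LinearMap.ker (rightIdealRad e).mkQ ≃ₗ[Aᵐᵒᵖ] rightIdealRad e :=
      LinearEquiv.ofEq _ _ (Submodule.ker_mkQ _)
    obtain ⟨ψ, hψ⟩ := hExt.exists_extend (Submodule.mkQ_surjective (rightIdealRad e))
      (φ.symm.toLinearMap ∘ₗ q ∘ₗ κ.toLinearMap)
    have hq0 : ∀ w, q w = 0 := by
      intro w
      have h1 := hψ (κ.symm w)
      have h2 : ψ (κ.symm w : rightIdeal e) = 0 := by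
        obtain ⟨r, hr, hw⟩ := w.2
        have h3 : ((κ.symm w : rightIdeal e)) = op r • rightIdealOne e := Subtype.ext hw
        rw [h3, map_smul]
        exact smul_topAt_eq_zero hee hr _
      rw [h2] at h1
      apply φ.symm.injective
      rw [map_zero]
      simpa using h1.symm
    have := IsSimpleModule.nontrivial Aᵐᵒᵖ X
    obtain ⟨x, hx⟩ := exists_ne (0 : X)
    obtain ⟨w, rfl⟩ := hq x
    exact hx (hq0 w)

/-- A module killed by `1 - e` is the sum of the images of `S_e` in it: the map `eA → H`, `a ↦ x a`,
vanishes on the two-sided ideal generated by `1 - e`, hence on `e rad A`. -/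
lemma exists_linearEquiv_finsupp_topAt (hright : IsNoetherianRing Aᵐᵒᵖ)
    (hsemi : IsSemiperfectRing A)
    {e : A} (he : IsPrimitiveIdempotent e) (hExt : ExtVanishes Aᵐᵒᵖ (topAt e) (topAt e) 1)
    (H : Type u) [AddCommGroup H] [Module Aᵐᵒᵖ H] (hH : ∀ x : H, op (1 - e) • x = 0) :
    ∃ ι : Type u, Nonempty (H ≃ₗ[Aᵐᵒᵖ] ι →₀ topAt e) := by
  have hsimple := isSimpleModule_topAt hsemi he
  have htop : isotypicComponent Aᵐᵒᵖ H (topAt e) = ⊤ := by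
    refine Submodule.eq_top_iff'.mpr fun x => ?_
    have hJ : ∀ r ∈ Ring.jacobson A, op (e * r) • x = 0 := by
      intro r hr
      refine Submodule.span_induction (p := fun y _ => op y • x = 0) ?_ ?_ ?_ ?_
        (mul_mem_span_of_ext_one hright hsemi he hExt hr)
      · rintro _ ⟨a, rfl⟩
        change op (e * a * (1 - e)) • x = 0
        rw [op_mul, mul_smul, hH]
      · exact zero_smul Aᵐᵒᵖ x
      · intro y z _ _ hy hz
        exact (add_smul (op y) (op z) x).trans (by rw [hy, hz, add_zero])
      · intro c y _ hy
        rw [MulOpposite.smul_eq_mul_unop, op_mul, mul_smul, hy, smul_zero]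
    obtain ⟨φ, rfl⟩ := exists_topAt_lift (op_smul_eq_self_of_one_sub (hH x)) hJ
    rcases φ.injective_or_eq_zero with hφ | rfl
    · have hle : LinearMap.range φ ≤ isotypicComponent Aᵐᵒᵖ H (topAt e) :=
        le_sSup ⟨(LinearEquiv.ofInjective φ hφ).symm⟩
      exact hle ⟨_, rfl⟩
    · exact zero_mem _
  have hss : IsSemisimpleModule Aᵐᵒᵖ H := by
    have h : IsSemisimpleModule Aᵐᵒᵖ (isotypicComponent Aᵐᵒᵖ H (topAt e)) := inferInstance
    rw [htop] at h
    exact h.congr Submodule.topEquiv.symm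
  exact (IsIsotypicOfType.of_isotypicComponent_eq_top htop).linearEquiv_finsupp

end Semiperfect

theorem mainTheorem1 {k : Type*} [Field k] [IsAlgClosed k]
    {A : Type u} [Ring A] [Algebra k A]
    (hleft : IsNoetherianRing A) (hright : IsNoetherianRing Aᵐᵒᵖ)
    (hsemi : IsSemiperfectRing A)
    (hfin : Module.Finite k (A ⧸ Ring.jacobson A))
    (e : A) (he : IsPrimitiveIdempotent e)
    (hbasic : ¬ IsSummandOf Aᵐᵒᵖ (rightIdeal e) (rightIdeal (1 - e)))
    (hExt : SelfExtVanishes Aᵐᵒᵖ (topAt e) 1)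
    (hpdA : HasFiniteProjDim Aᵐᵒᵖ (topAt e))
    (hpdΓ : HasFiniteProjDim (he.isIdempotentElem.one_sub.Corner)ᵐᵒᵖ
      (cornerPart (1 - e) (rightIdeal e))) :
    IsSelfOrthogonal Aᵐᵒᵖ (topAt e) := by
  classical
  intro i hi
  by_contra hne
  obtain ⟨n, hn⟩ := (projectiveDimension_ne_top_iff _).mp hpdA.ne
  obtain ⟨d, hd⟩ := (projectiveDimension_ne_top_iff _).mp hpdΓ.ne
  have hvan : ∀ j, n < j → ExtVanishes Aᵐᵒᵖ (topAt e) (topAt e) j := fun j hj =>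
    HasProjectiveDimensionLT.subsingleton (ModuleCat.of Aᵐᵒᵖ (topAt e)) (n + 1) j hj _
  -- The top degree `m ≥ i > 0` in which `Ext(S_e, S_e)` does not vanish.
  let m := Nat.findGreatest (fun j => ¬ ExtVanishes Aᵐᵒᵖ (topAt e) (topAt e) j) n
  have hin : i ≤ n := by
    by_contra h
    exact hne (hvan i (by omega))
  have hm : ¬ ExtVanishes Aᵐᵒᵖ (topAt e) (topAt e) m :=
    Nat.findGreatest_spec (P := fun j => ¬ ExtVanishes Aᵐᵒᵖ (topAt e) (topAt e) j) hin hne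
  have him : i ≤ m := Nat.le_findGreatest hin hne
  have hm' : ∀ j, m < j → ExtVanishes Aᵐᵒᵖ (topAt e) (topAt e) j := by
    intro j hj
    by_cases hjn : j ≤ n
    · exact not_not.mp (Nat.findGreatest_is_greatest hj hjn)
    · exact hvan j (by omega)
  have hproj := projective_rightIdeal he.isIdempotentElem
  have h0 := extVanishes_of_cornerPart he.isIdempotentElem.one_sub
    (smul_one_sub_topAt hsemi he hbasic)
    (exists_linearEquiv_finsupp_topAt hright hsemi he hExt) hm hm' (d + 1) (rightIdeal e) hd
    (fun j hj => by
      obtain ⟨j, rfl⟩ : ∃ l, j = l + 1 := ⟨j - 1, by omega⟩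
      exact ExtVanishes.of_projective) 0
  have h1 := ExtVanishes.zero_iff.mp h0 (rightIdealRad e).mkQ
  exact topAtOne_ne_zero he (LinearMap.congr_fun h1 (rightIdealOne e))
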